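/- Work in the Euclidean plane $\mathbb R^2$. A \emph{spring} is a segment $[a,b]$, $a\ne b$, with a coefficient $\lambda\in\mathbb R$; put $u=\frac{b-a}{|b-a|}$. It is \emph{compressed} if $\lambda>0$ and \emph{stretched} if $\lambda<0$; its boundary force is the vector measure $\lambda(\delta_b-\delta_a)u$, its mass is $|\lambda|\,|b-a|$, and its stress is the matrix measure $\lambda\,(u\otimes u)\,\mathcal H^1\llcorner[a,b]$. Boundary forces and masses of a finite system of springs are the sums of those of its members. A \emph{generalized spring system} $T$ is a compactly supported finite measure $T=A\mu$ with values in the symmetric $2\times2$ matrices ($\mu$ a finite positive Borel measure, $A$ integrable). Its mass is $\mathbb M(T)=\int |A|\,d\mu$, where $|A|$ is the sum of the absolute values of the eigenvalues of $A$. Its boundary force is the distribution $\varphi\mapsto\int\sum_{i,j}A_{ij}\,\partial_j\varphi_i\,d\mu$, for $\varphi\in C_c^\infty(\mathbb R^2;\mathbb R^2)$. Finite spring systems are included through the sums of their stresses. Let $\mathbf F=\sum_{i=1}^{l}F_i\,\delta_{M_i}$ be a finite system of pointed forces in equilibrium, that is, $\sum_iF_i=0$ and $\sum_iF_i\wedge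 M_i=0$. Let $T$ be a minimizer for $\mathbf F$: a generalized spring system with boundary force $\mathbf F$ whose mass is at most the mass of every finite spring system with boundary force $\mathbf F$. Let $p\notin\{M_1,\dots,M_l\}$ be a point at which finitely many springs of $T$ meet: there are finitely many springs, each containing $p$ (as an endpoint or as an interior point), any two of them meeting only at $p$, such that in some disc around $p$ the measure $T$ is the sum of their stresses. Then: 1. the boundary forces of these springs at $p$ sum to zero; 2. the angle between any stretched spring and any compressed spring among them is $90^\circ$. -/

import Mathlib

open MeasureTheory
open scoped ContDiff

noncomputable section

/-- The Euclidean plane. -/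
abbrev Plane : Type := EuclideanSpace ℝ (Fin 2)

/-- A spring: a nondegenerate segment `[a, b]` with a coefficient `coeff`, that is, the stressed
segment `(coeff • u ⊗ u) ⊗ [a, b]`, where `u` is the unit vector from `a` to `b`. -/
structure Spring where
  a : Plane
  b : Plane
  ne : a ≠ b
  coeff : ℝ

namespace Spring

/-- The unit vector from `a` to `b`. -/
def dir (s : Spring) : Plane := ‖s.b - s.a‖⁻¹ • (s.b - s.a)

/-- The points of the spring. -/
def carrier (s : Spring) : Set Plane := segment ℝ s.a s.b

/-- A compressed spring pushes outward on its endpoints. -/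
def IsCompressed (s : Spring) : Prop := 0 < s.coeff

/-- A stretched spring pulls inward on its endpoints. -/
def IsStretched (s : Spring) : Prop := s.coeff < 0

open Classical in
/-- The force of the spring at the point `x`: this is `coeff • (δ_b - δ_a) u` at `x`, so it is
zero unless `x` is an endpoint. -/
def boundaryForce (s : Spring) (x : Plane) : Plane :=
  (if x = s.b then s.coeff • s.dir else 0) - (if x = s.a then s.coeff • s.dir else 0)

/-- The `(i, j)` entry of the stress carried by the spring in a set `S`: the integral of the matrix
`coeff • u ⊗ u` over `S ∩ [a, b]` with respect to length. -/
def stressOn (s : Spring) (S : Set Plane) (i j : Fin 2) : ℝ :=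
  s.coeff * s.dir i * s.dir j * (Measure.hausdorffMeasure 1 (S ∩ s.carrier)).toReal

end Spring

/-- The mass of a finite spring system: coefficient (in absolute value) times length, summed. -/
def springMass {n : ℕ} (P : Fin n → Spring) : ℝ :=
  ∑ k, |(P k).coeff| * dist (P k).a (P k).b

/-- A system of pointed forces `F i` applied at `M i` is in equilibrium: the net force and the net
torque vanish. -/
def IsEquilibrium {ι : Type*} [Fintype ι] (M F : ι → Plane) : Prop :=
  ∑ i, F i = 0 ∧ ∑ i, (F i 0 * M i 1 - F i 1 * M i 0) = 0

open Classical in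
/-- The boundary of the finite spring system `P` is the system of forces `∑ i, F i δ_{M i}`. -/
def SpringBoundaryEq {n : ℕ} {ι : Type*} [Fintype ι] (P : Fin n → Spring) (M F : ι → Plane) :
    Prop :=
  ∀ x : Plane, ∑ k, (P k).boundaryForce x = ∑ i, if M i = x then F i else 0

/-- The cost of a symmetric matrix: the sum of the absolute values of its eigenvalues. -/
def matrixCost {A : Matrix (Fin 2) (Fin 2) ℝ} (hA : A.IsHermitian) : ℝ :=
  ∑ i, |hA.eigenvalues i|

/-- A generalized spring system: a compactly supported measure with values in the symmetric
`2 × 2` matrices, in the polar form `density • base`.  A finite spring system is the case of the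
sum of the matrices `coeff • u ⊗ u` times the length measures of its segments; limits of finite
systems, in which springs smear out, are of this form too. -/
structure StressMeasure where
  base : Measure Plane
  finite : IsFiniteMeasure base
  compactSupport : ∃ K : Set Plane, IsCompact K ∧ base Kᶜ = 0
  density : Plane → Matrix (Fin 2) (Fin 2) ℝ
  symmetric : ∀ x, (density x).IsHermitian
  integrable : ∀ i j, Integrable (fun x => density x i j) base

namespace StressMeasure

/-- The mass of a generalized spring system. -/
def mass (T : StressMeasure) : ℝ := ∫ x, matrixCost (T.symmetric x) ∂T.base

/-- The boundary of `T` is the system of forces `∑ i, F i δ_{M i}`, in the sense of distributions.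
For a single spring, `∫ ⟨T, Dφ⟩ = coeff * ⟪u, φ b - φ a⟫`. -/
def BoundaryEq (T : StressMeasure) {ι : Type*} [Fintype ι] (M F : ι → Plane) : Prop :=
  ∀ φ : Plane → Plane, ContDiff ℝ ∞ φ → HasCompactSupport φ →
    ∫ x, ∑ i, ∑ j, T.density x i j * (fderiv ℝ φ x (EuclideanSpace.single j 1)) i ∂T.base
      = ∑ k, inner ℝ (F k) (φ (M k))

/-- `T` is a minimizer for the forces `∑ i, F i δ_{M i}`: it has this boundary, and its mass does
not exceed that of any finite spring system with this boundary. -/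
def IsMinimizer (T : StressMeasure) {ι : Type*} [Fintype ι] (M F : ι → Plane) : Prop :=
  T.BoundaryEq M F ∧
    ∀ (n : ℕ) (P : Fin n → Spring), SpringBoundaryEq P M F → T.mass ≤ springMass P

/-- Near `p`, the system `T` consists of the finitely many springs `s k`, which all contain `p`
(as an endpoint or in the interior) and meet each other only at `p`. -/
def IsSpringsNear (T : StressMeasure) (p : Plane) {κ : Type*} [Fintype κ] (s : κ → Spring) :
    Prop :=
  (∀ k, p ∈ (s k).carrier) ∧
  (∀ k l, k ≠ l → (s k).carrier ∩ (s l).carrier = {p}) ∧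
  ∃ r : ℝ, 0 < r ∧ ∀ S : Set Plane, MeasurableSet S → S ⊆ Metric.ball p r →
    ∀ i j, ∫ x in S, T.density x i j ∂T.base = ∑ k, (s k).stressOn S i j

end StressMeasure

end

/-!
By Hahn–Banach duality, the minimal mass equals the largest work `∑ i, ⟪F i, φ (M i)⟫` of the forces
over displacement fields `φ` of strain at most one. Testing a minimizer against an optimal `φ` shows
that `φ` has strain exactly `1` along its compressed springs and exactly `-1` along its stretched
ones. Comparing `φ` on two segments of opposite extremal strain issuing from `p` shows that a
compressed and a stretched branch never meet at an acute angle. The branches at `p` are in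
balance: `∑ i, c i • v i = 0`, with `v i` the unit vector along the `i`-th branch. Taking the inner
product of the compressed part of this sum with the stretched part, all the pairwise inner products
have one sign and their weighted sum the other, so they all vanish.
-/

open scoped InnerProductSpace Topology

open scoped PosPart in
/-- Move the negative terms to the other side and take the inner product of the two sides. -/
theorem inner_eq_zero_of_sum_smul_eq_zero {E α : Type*} [NormedAddCommGroup E]
    [InnerProductSpace ℝ E] [Fintype α] {c : α → ℝ} {v : α → E} (hsum : ∑ i, c i • v i = 0)
    (hnonpos : ∀ i j, 0 < c i → c j < 0 → ⟪v i, v j⟫_ℝ ≤ 0) {i j : α} (hi : 0 < c i)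
    (hj : c j < 0) : ⟪v i, v j⟫_ℝ = 0 := by
  have hbalance : ∑ i, (c i)⁺ • v i = ∑ j, (c j)⁻ • v j := by
    rw [← sub_eq_zero, ← Finset.sum_sub_distrib, ← hsum]
    simp only [← sub_smul, posPart_sub_negPart]
  have hterm : ∀ i j, 0 ≤ -((c j)⁻ * ((c i)⁺ * ⟪v i, v j⟫_ℝ)) := fun i j => by
    rcases le_or_gt (c i) 0 with hi | hi
    · simp [posPart_eq_zero.2 hi]
    rcases le_or_gt 0 (c j) with hj | hj
    · simp [negPart_eq_zero.2 hj]
    exact neg_nonneg.2 (mul_nonpos_of_nonneg_of_nonpos (negPart_nonneg _)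
      (mul_nonpos_of_nonneg_of_nonpos (posPart_nonneg _) (hnonpos i j hi hj)))
  have htotal : ∑ x : α × α, -((c x.2)⁻ * ((c x.1)⁺ * ⟪v x.1, v x.2⟫_ℝ)) = 0 := by
    refine le_antisymm ?_ (Finset.sum_nonneg fun x _ => hterm x.1 x.2)
    calc ∑ x : α × α, -((c x.2)⁻ * ((c x.1)⁺ * ⟪v x.1, v x.2⟫_ℝ))
        = -⟪∑ i, (c i)⁺ • v i, ∑ j, (c j)⁻ • v j⟫_ℝ := by
          simp only [Fintype.sum_prod_type_right, sum_inner, inner_sum, real_inner_smul_left,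
            real_inner_smul_right, Finset.sum_neg_distrib]
      _ ≤ 0 := by
          rw [hbalance]
          exact neg_nonpos.2 real_inner_self_nonneg
  have h := (Finset.sum_eq_zero_iff_of_nonneg fun x _ => hterm x.1 x.2).1 htotal (i, j)
    (Finset.mem_univ _)
  simpa only [neg_eq_zero, mul_eq_zero, posPart_eq_zero, negPart_eq_zero, hi.not_ge, hj.not_ge,
    false_or] using h

/-! ### Fields of strain at most one -/

section DualField

variable {E : Type*} [NormedAddCommGroup E] [InnerProductSpace ℝ E] {φ : E → E} {p d e v : E}

/-- Displacement fields of strain at most one: the admissible fields of the problem dual to mass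
minimization. The strain is bounded through difference quotients, so no differentiability is
required. -/
def IsDualField (φ : E → E) : Prop :=
  ∀ x y, |⟪φ x - φ y, x - y⟫_ℝ| ≤ ‖x - y‖ ^ 2

/-- The field `φ` attains the largest strain allowed to a dual field along the segment
`[p, p + d]`. -/
def HasUnitStrainAlong (φ : E → E) (p d : E) : Prop :=
  ∀ t ∈ Set.Icc (0 : ℝ) 1, ⟪φ (p + t • d) - φ p, d⟫_ℝ = t * ‖d‖ ^ 2

theorem HasUnitStrainAlong.inner_sub (h : HasUnitStrainAlong φ p d) :
    ⟪φ (p + d) - φ p, d⟫_ℝ = ‖d‖ ^ 2 := by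
  simpa using h 1 (by simp)

theorem HasUnitStrainAlong.smul (h : HasUnitStrainAlong φ p d) {r : ℝ} (hr : r ∈ Set.Icc 0 1) :
    HasUnitStrainAlong φ p (r • d) := by
  intro t ht
  rw [smul_smul, inner_smul_right, h (t * r) (unitInterval.mul_mem ht hr), norm_smul, mul_pow,
    Real.norm_eq_abs, sq_abs]
  ring

namespace IsDualField

theorem id : IsDualField (id : E → E) := fun x y => by
  simp

theorem neg (hφ : IsDualField φ) : IsDualField (-φ) := by
  intro x y
  simpa only [Pi.neg_apply, neg_sub_neg, ← neg_sub (φ x), inner_neg_left, abs_neg] using hφ x y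

theorem hasUnitStrainAlong_of_le (hφ : IsDualField φ) {η : ℝ} (hη : 0 ≤ η) (hv : ‖v‖ = 1)
    (h : ∀ t ∈ Set.Icc 0 η, t ≤ ⟪φ (p + t • v) - φ p, v⟫_ℝ) :
    HasUnitStrainAlong φ p (η • v) := by
  intro t ht
  have htη : 0 ≤ t * η := mul_nonneg ht.1 hη
  have hle : t * η * ⟪φ (p + (t * η) • v) - φ p, v⟫_ℝ ≤ (t * η) ^ 2 := by
    have hstrain := (abs_le.1 (hφ (p + (t * η) • v) p)).2
    rwa [add_sub_cancel_left, inner_smul_right, norm_smul, hv, mul_one, Real.norm_eq_abs,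
      sq_abs] at hstrain
  have hge := h (t * η) ⟨htη, mul_le_of_le_one_left hη ht.2⟩
  rw [smul_smul, inner_smul_right, norm_smul, hv, mul_one, Real.norm_of_nonneg hη]
  rcases htη.eq_or_lt with h₀ | hpos
  · rcases mul_eq_zero.1 h₀.symm with rfl | rfl <;> simp
  · have heq := hge.antisymm (le_of_mul_le_mul_left (hle.trans_eq (sq _)) hpos)
    rw [← heq]
    ring

/-- Test the strain bound between `x + h • w` and each of `x + d`, `x - d`, `x`, where
`w = 2 φ x - φ (x + d) - φ (x - d)` is orthogonal to `d`: the sum of the three inequalities is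
`h * ‖w‖ ^ 2 ≤ 4 * h ^ 2 * ‖w‖ ^ 2`, which forces `w = 0` for small `h > 0`. -/
theorem add_eq_two_smul_of_inner_eq (hφ : IsDualField φ) {x : E}
    (hfwd : ⟪φ (x + d) - φ x, d⟫_ℝ = ‖d‖ ^ 2) (hbwd : ⟪φ x - φ (x - d), d⟫_ℝ = ‖d‖ ^ 2) :
    φ (x + d) + φ (x - d) = (2 : ℝ) • φ x := by
  set w := (2 : ℝ) • φ x - φ (x + d) - φ (x - d) with hw
  have hwd : ⟪w, d⟫_ℝ = 0 := by
    rw [show w = (φ x - φ (x - d)) - (φ (x + d) - φ x) by rw [hw, two_smul]; abel,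
      inner_sub_left, hfwd, hbwd, sub_self]
  have hww : ‖w‖ ^ 2 = 2 * ⟪φ x, w⟫_ℝ - ⟪φ (x + d), w⟫_ℝ - ⟪φ (x - d), w⟫_ℝ := by
    rw [← real_inner_self_eq_norm_sq]
    nth_rewrite 1 [hw]
    simp only [inner_sub_left, real_inner_smul_left]
  have hadd := (abs_le.1 (hφ (x + (1 / 8 : ℝ) • w) (x + d))).2
  have hsub := (abs_le.1 (hφ (x + (1 / 8 : ℝ) • w) (x - d))).2
  have hmid := (abs_le.1 (hφ (x + (1 / 8 : ℝ) • w) x)).1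
  rw [add_sub_add_left_eq_sub, norm_sub_sq_real] at hadd
  rw [add_sub_sub_cancel, norm_add_sq_real] at hsub
  rw [add_sub_cancel_left] at hmid
  simp only [inner_sub_left, inner_sub_right, inner_add_right, real_inner_smul_left,
    real_inner_smul_right, norm_smul, mul_pow, Real.norm_eq_abs, sq_abs, hwd]
    at hadd hsub hmid hfwd hbwd
  have hnorm : ‖w‖ ^ 2 = 0 := le_antisymm (by linarith) (sq_nonneg _)
  have hzero : w = 0 := norm_eq_zero.1 (pow_eq_zero_iff two_ne_zero |>.1 hnorm)
  rw [hw, sub_sub, sub_eq_zero] at hzero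
  exact hzero.symm

theorem map_add_half_smul_sub (hφ : IsDualField φ) (h : HasUnitStrainAlong φ p d) :
    φ (p + (1 / 2 : ℝ) • d) - φ p = (1 / 2 : ℝ) • (φ (p + d) - φ p) := by
  set c := (1 / 2 : ℝ) • d with hc
  have hd : p + d = p + c + c := by rw [add_assoc, hc, ← add_smul]; norm_num
  have hhalf : ⟪φ (p + c) - φ p, c⟫_ℝ = ‖c‖ ^ 2 :=
    (h.smul (by norm_num : (1 / 2 : ℝ) ∈ Set.Icc 0 1)).inner_sub
  have hwhole : ⟪φ (p + c + c) - φ p, c⟫_ℝ = 2 * ‖c‖ ^ 2 := by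
    rw [← hd, hc, real_inner_smul_right, h.inner_sub, norm_smul]
    norm_num
    ring
  have hmid := hφ.add_eq_two_smul_of_inner_eq (x := p + c) (d := c)
    (by rw [← sub_sub_sub_cancel_right _ _ (φ p), inner_sub_left, hwhole, hhalf]; ring)
    (by rw [add_sub_cancel_right, hhalf])
  rw [add_sub_cancel_right, ← hd] at hmid
  rw [eq_sub_of_add_eq hmid]
  module

theorem map_add_half_pow_smul_sub (hφ : IsDualField φ) (h : HasUnitStrainAlong φ p d) (n : ℕ) :
    φ (p + (1 / 2 : ℝ) ^ n • d) - φ p = (1 / 2 : ℝ) ^ n • (φ (p + d) - φ p) := by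
  induction n with
  | zero => simp
  | succ n ih =>
    have hpow : (1 / 2 : ℝ) ^ n ∈ Set.Icc 0 1 :=
      ⟨by positivity, pow_le_one₀ (by norm_num) (by norm_num)⟩
    rw [pow_succ', mul_smul, mul_smul, hφ.map_add_half_smul_sub (h.smul hpow), ih]

/-- Compare the strain bounds for the pairs `(p + τ • d, p + e)` and `(p + d, p + τ • e)` at a
dyadic scale `τ → 0`. -/
theorem inner_nonpos_of_hasUnitStrainAlong (hφ : IsDualField φ) (hd : HasUnitStrainAlong φ p d)
    (he : HasUnitStrainAlong (-φ) p e) : ⟪d, e⟫_ℝ ≤ 0 := by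
  set X := φ (p + d) - φ p with hX
  set Y := φ (p + e) - φ p with hY
  have hXd : ⟪X, d⟫_ℝ = ‖d‖ ^ 2 := hd.inner_sub
  have hYe : ⟪Y, e⟫_ℝ = -‖e‖ ^ 2 := by
    rw [← he.inner_sub, ← inner_neg_left, Pi.neg_apply, Pi.neg_apply, neg_sub_neg, neg_sub]
  have hscale : ∀ n : ℕ, 2 * ⟪d, e⟫_ℝ ≤ (1 / 2 : ℝ) ^ n * (‖d‖ ^ 2 + ‖e‖ ^ 2) := by
    intro n
    have hXn := hφ.map_add_half_pow_smul_sub hd n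
    have hYn : φ (p + (1 / 2 : ℝ) ^ n • e) - φ p = (1 / 2 : ℝ) ^ n • Y := by
      have h := hφ.neg.map_add_half_pow_smul_sub he n
      simp only [Pi.neg_apply, neg_sub_neg] at h
      rw [← neg_sub, h, ← smul_neg, neg_sub]
    set τ : ℝ := (1 / 2 : ℝ) ^ n
    have hτ : 0 < τ := by positivity
    have hXY : φ (p + τ • d) - φ (p + e) = τ • X - Y := by rw [← hXn, hY]; abel
    have hYX : φ (p + d) - φ (p + τ • e) = X - τ • Y := by rw [← hYn, hX]; abel
    have hlower := (abs_le.1 (hφ (p + τ • d) (p + e))).1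
    have hupper := (abs_le.1 (hφ (p + d) (p + τ • e))).2
    rw [hXY, add_sub_add_left_eq_sub, norm_sub_sq_real] at hlower
    rw [hYX, add_sub_add_left_eq_sub, norm_sub_sq_real] at hupper
    simp only [inner_sub_left, inner_sub_right, real_inner_smul_left, real_inner_smul_right,
      norm_smul, mul_pow, Real.norm_eq_abs, sq_abs, hXd, hYe] at hlower hupper
    refine le_of_mul_le_mul_left ?_ hτ
    linarith
  have hlim : Filter.Tendsto (fun n : ℕ => (1 / 2 : ℝ) ^ n * (‖d‖ ^ 2 + ‖e‖ ^ 2)) Filter.atTop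
      (𝓝 (0 * (‖d‖ ^ 2 + ‖e‖ ^ 2))) :=
    (tendsto_pow_atTop_nhds_zero_of_lt_one (by norm_num) (by norm_num)).mul_const _
  linarith [ge_of_tendsto' hlim hscale]

/-- Two strain bounds through the intermediate point `z = y + (φ x - φ y) / 6`. -/
theorem norm_sub_sq_le (hφ : IsDualField φ) (x y : E) :
    ‖φ x - φ y‖ ^ 2 ≤ 12 * (2 * ‖x - y‖ ^ 2 +
      ‖φ x - φ (y + (1 / 6 : ℝ) • (φ x - φ y))‖ * ‖x - y‖) := by
  set w := φ x - φ y with hw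
  set z := y + (1 / 6 : ℝ) • w with hz
  have hxz := (abs_le.1 (hφ x z)).1
  have hzy := (abs_le.1 (hφ z y)).2
  have hcs := real_inner_le_norm (φ x - φ z) (x - y)
  have hcs' := (abs_le.1 (abs_real_inner_le_norm (x - y) w)).1
  rw [show φ z - φ y = w - (φ x - φ z) by rw [hw]; abel,
    show z - y = (1 / 6 : ℝ) • w by rw [hz]; abel] at hzy
  rw [show x - z = (x - y) - (1 / 6 : ℝ) • w by rw [hz]; abel, norm_sub_sq_real] at hxz
  set a := φ x - φ z
  rw [inner_sub_right] at hxz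
  rw [inner_sub_left] at hzy
  simp only [real_inner_smul_right, norm_smul, mul_pow, Real.norm_eq_abs, sq_abs,
    real_inner_self_eq_norm_sq] at hxz hzy
  nlinarith [sq_nonneg (‖x - y‖ - ‖w‖ / 6)]

/-- Testing the strain bound of `z` against `0` and against `e` isolates the component of `φ z`
along `e = z - (z - e)`. -/
theorem abs_inner_le (hφ : IsDualField φ) (z e : E) :
    |⟪φ z, e⟫_ℝ| ≤ ‖z‖ ^ 2 + ‖φ 0‖ * ‖z‖ + (‖z - e‖ ^ 2 + ‖φ e‖ * ‖z - e‖) := by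
  have htest : ∀ y, |⟪φ z, z - y⟫_ℝ| ≤ ‖z - y‖ ^ 2 + ‖φ y‖ * ‖z - y‖ := fun y =>
    calc |⟪φ z, z - y⟫_ℝ| = |⟪φ z - φ y, z - y⟫_ℝ + ⟪φ y, z - y⟫_ℝ| := by
          rw [← inner_add_left, sub_add_cancel]
      _ ≤ _ := (abs_add_le _ _).trans (add_le_add (hφ z y) (abs_real_inner_le_norm _ _))
  calc |⟪φ z, e⟫_ℝ| = |⟪φ z, z - 0⟫_ℝ - ⟪φ z, z - e⟫_ℝ| := by
        rw [← inner_sub_right, sub_sub_sub_cancel_left, sub_zero]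
    _ ≤ _ := (abs_sub _ _).trans (add_le_add (by simpa using htest 0) (htest e))

section FiniteDimensional

variable [FiniteDimensional ℝ E]

theorem exists_norm_le_on_closedBall (hφ : IsDualField φ) (ρ : ℝ) :
    ∃ R, ∀ z, ‖z‖ ≤ ρ → ‖φ z‖ ≤ R := by
  let b := stdOrthonormalBasis ℝ E
  refine ⟨∑ i, (ρ ^ 2 + ‖φ 0‖ * ρ + ((ρ + 1) ^ 2 + ‖φ (b i)‖ * (ρ + 1))), fun z hz => ?_⟩
  calc ‖φ z‖ = ‖∑ i, ⟪b i, φ z⟫_ℝ • b i‖ := by rw [b.sum_repr']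
    _ ≤ ∑ i, |⟪φ z, b i⟫_ℝ| := norm_sum_le_of_le _ fun i _ => by
      rw [norm_smul, b.norm_eq_one, mul_one, real_inner_comm, Real.norm_eq_abs]
    _ ≤ _ := Finset.sum_le_sum fun i _ => by
      have hzb : ‖z - b i‖ ≤ ρ + 1 := (norm_sub_le _ _).trans (by rw [b.norm_eq_one]; gcongr)
      refine (hφ.abs_inner_le z (b i)).trans ?_
      gcongr

theorem continuous (hφ : IsDualField φ) : Continuous φ := by
  refine continuous_iff_continuousAt.2 fun y => ?_
  obtain ⟨R, hR⟩ := hφ.exists_norm_le_on_closedBall (‖y‖ + 1)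
  obtain ⟨R', hR'⟩ := hφ.exists_norm_le_on_closedBall (‖y‖ + (R + R))
  have hbound : ∀ᶠ x in 𝓝 y,
      ‖φ x - φ y‖ ≤ √(12 * (2 * ‖x - y‖ ^ 2 + (R + R') * ‖x - y‖)) := by
    filter_upwards [Metric.closedBall_mem_nhds y one_pos] with x hx
    rw [mem_closedBall_iff_norm] at hx
    have hφx : ‖φ x‖ ≤ R := hR x (by linarith [norm_le_norm_add_norm_sub' x y])
    have hφy : ‖φ y‖ ≤ R := hR y (by linarith)
    have hw : ‖φ x - φ y‖ ≤ R + R := (norm_sub_le _ _).trans (add_le_add hφx hφy)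
    have hφz := hR' (y + (1 / 6 : ℝ) • (φ x - φ y)) ((norm_add_le _ _).trans (by
      rw [norm_smul, Real.norm_of_nonneg (by norm_num)]
      linarith [norm_nonneg (φ x - φ y)]))
    refine Real.le_sqrt_of_sq_le ((hφ.norm_sub_sq_le x y).trans ?_)
    gcongr
    exact (norm_sub_le _ _).trans (add_le_add hφx hφz)
  have hlim : Filter.Tendsto (fun x => √(12 * (2 * ‖x - y‖ ^ 2 + (R + R') * ‖x - y‖)))
      (𝓝 y) (𝓝 0) := by
    have : Continuous fun x => √(12 * (2 * ‖x - y‖ ^ 2 + (R + R') * ‖x - y‖)) := by fun_prop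
    simpa using this.tendsto y
  exact tendsto_iff_norm_sub_tendsto_zero.2 (squeeze_zero' (.of_forall fun _ => norm_nonneg _)
    hbound hlim)

open ContinuousLinearMap in
theorem convolution [MeasurableSpace E] [BorelSpace E] (hφ : IsDualField φ)
    (η : ContDiffBump (0 : E)) :
    IsDualField (MeasureTheory.convolution (η.normed volume) φ (lsmul ℝ ℝ) volume) := by
  intro x y
  have hint : ∀ z, Integrable fun t => η.normed volume t • φ (z - t) := fun z =>
    (η.continuous_normed.smul (hφ.continuous.comp (by fun_prop))).integrable_of_hasCompactSupport
      η.hasCompactSupport_normed.smul_right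
  have hsub : Integrable fun t => η.normed volume t • (φ (x - t) - φ (y - t)) := by
    simp only [smul_sub]
    exact (hint x).sub (hint y)
  simp only [convolution_def, lsmul_apply]
  rw [← integral_sub (hint x) (hint y)]
  simp only [← smul_sub]
  calc |⟪∫ t, η.normed volume t • (φ (x - t) - φ (y - t)), x - y⟫_ℝ|
      = ‖∫ t, ⟪x - y, η.normed volume t • (φ (x - t) - φ (y - t))⟫_ℝ‖ := by
        rw [integral_inner hsub, real_inner_comm, Real.norm_eq_abs]
    _ ≤ ∫ t, η.normed volume t * ‖x - y‖ ^ 2 := by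
        refine norm_integral_le_of_norm_le (η.integrable_normed.mul_const _)
          (.of_forall fun t => ?_)
        have hstrain := hφ (x - t) (y - t)
        rw [sub_sub_sub_cancel_right] at hstrain
        rw [real_inner_smul_right, norm_mul, Real.norm_of_nonneg (η.nonneg_normed t),
          real_inner_comm]
        exact mul_le_mul_of_nonneg_left hstrain (η.nonneg_normed t)
    _ = ‖x - y‖ ^ 2 := by rw [integral_mul_const, η.integral_normed, one_mul]

theorem exists_contDiff_tendsto (hφ : IsDualField φ) :
    ∃ ψ : ℕ → E → E, (∀ n, ContDiff ℝ ∞ (ψ n) ∧ IsDualField (ψ n)) ∧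
      ∀ x, Filter.Tendsto (fun n => ψ n x) Filter.atTop (𝓝 (φ x)) := by
  borelize E
  let η : ℕ → ContDiffBump (0 : E) := fun n =>
    ⟨1 / (n + 1) / 2, 1 / (n + 1), by positivity, half_lt_self (by positivity)⟩
  exact ⟨fun n => MeasureTheory.convolution ((η n).normed volume) φ
    (ContinuousLinearMap.lsmul ℝ ℝ) volume, fun n =>
      ⟨(η n).hasCompactSupport_normed.contDiff_convolution_left _ (η n).contDiff_normed
        hφ.continuous.locallyIntegrable, hφ.convolution (η n)⟩,
    ContDiffBump.convolution_tendsto_right_of_continuous tendsto_one_div_add_atTop_nhds_zero_nat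
      hφ.continuous⟩

end FiniteDimensional

theorem abs_inner_fderiv_le (hφ : IsDualField φ) {x : E} (hd : DifferentiableAt ℝ φ x) (w : E) :
    |⟪fderiv ℝ φ x w, w⟫_ℝ| ≤ ‖w‖ ^ 2 := by
  have hderiv : HasDerivAt (fun t : ℝ => ⟪φ (x + t • w), w⟫_ℝ) ⟪fderiv ℝ φ x w, w⟫_ℝ 0 := by
    simpa using hd.hasFDerivAt.hasLineDerivAt w |>.inner ℝ (hasDerivAt_const (0 : ℝ) w)
  refine hderiv.le_of_lip' (by positivity) (.of_forall fun t => ?_)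
  have h := hφ (x + t • w) x
  rw [add_sub_cancel_left, real_inner_smul_right, norm_smul, abs_mul, mul_pow, Real.norm_eq_abs,
    inner_sub_left] at h
  simp only [zero_smul, add_zero, sub_zero, Real.norm_eq_abs]
  rcases eq_or_ne t 0 with rfl | ht
  · simp
  · refine le_of_mul_le_mul_left ?_ (abs_pos.2 ht)
    linarith

end IsDualField

end DualField

/-! ### Duality -/

/-- The Hahn–Banach extension is made on `V`, where `N` lives, and factors through `D` because it
is nonpositive, hence zero, on `ker D`. -/
theorem exists_linearMap_le_seminorm_of_forall_le {V W : Type*} [AddCommGroup V] [Module ℝ V]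
    [AddCommGroup W] [Module ℝ W] (D : V →ₗ[ℝ] W) (N : Seminorm ℝ V) {G : W}
    (hG : G ∈ LinearMap.range D) {m : ℝ} (hm : ∀ w, D w = G → m ≤ N w) :
    ∃ L : W →ₗ[ℝ] ℝ, (∀ w, L (D w) ≤ N w) ∧ m ≤ L G := by
  rcases le_or_gt m 0 with hm₀ | hm₀
  · exact ⟨0, fun w => apply_nonneg N w, hm₀⟩
  have hG₀ : G ≠ 0 := by
    rintro rfl
    exact hm₀.not_ge ((hm 0 (map_zero D)).trans_eq (map_zero N))
  obtain ⟨g, hgG⟩ : ∃ g : W →ₗ[ℝ] ℝ, g G = m := by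
    obtain ⟨g, hg, -⟩ := Submodule.exists_le_ker_of_notMem (K := ℝ) (p := ⊥) (v := G) (by simpa)
    exact ⟨(m / g G) • g, div_mul_cancel₀ _ hg⟩
  have hle : ∀ (w : V) (a : ℝ), D w = a • G → g (D w) ≤ N w := by
    intro w a hw
    rw [hw, map_smul, hgG, smul_eq_mul]
    rcases le_or_gt a 0 with ha | ha
    · exact (mul_nonpos_of_nonpos_of_nonneg ha hm₀.le).trans (apply_nonneg N w)
    · have h := hm (a⁻¹ • w) (by rw [map_smul, hw, inv_smul_smul₀ ha.ne'])
      rwa [map_smul_eq_mul, Real.norm_of_nonneg (inv_nonneg.2 ha.le), le_inv_mul_iff₀ ha] at h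
  obtain ⟨k, hk, hkN⟩ := exists_extension_of_le_sublinear
    ⟨(Submodule.span ℝ {G}).comap D, (g ∘ₗ D).domRestrict _⟩ N
    (fun c hc w => by rw [map_smul_eq_mul, Real.norm_of_nonneg hc.le]) (map_add_le_add N)
    (fun ⟨w, hw⟩ => by
      obtain ⟨a, ha⟩ := Submodule.mem_span_singleton.1 hw
      exact hle w a ha.symm)
  have hk_eq : ∀ w, D w ∈ Submodule.span ℝ {G} → k w = g (D w) := fun w hw => hk ⟨w, hw⟩
  obtain ⟨L, rfl⟩ : k ∈ LinearMap.range D.dualMap := by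
    rw [LinearMap.range_dualMap_eq_dualAnnihilator_ker, Submodule.mem_dualAnnihilator]
    intro w hw
    rw [LinearMap.mem_ker] at hw
    rw [hk_eq w (by simp [hw]), hw, map_zero]
  obtain ⟨w, rfl⟩ := hG
  exact ⟨L, hkN, hgG.ge.trans_eq (hk_eq w (Submodule.mem_span_singleton_self _)).symm⟩

section Framework

variable {E : Type*} [NormedAddCommGroup E]

/-- Finite systems of bars in `E`, as formal combinations of pairs of endpoints. The coefficient of
a bar is its force per unit length, so that a degenerate bar carries no force. -/
abbrev Framework (E : Type*) : Type _ := E × E →₀ ℝ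

namespace Framework

/-- The mass of a framework: force times length, that is, force density times squared length,
summed over the bars. -/
noncomputable def mass : Seminorm ℝ (Framework E) :=
  .of (fun w => w.sum fun e c => |c| * ‖e.2 - e.1‖ ^ 2)
    (fun v w => by
      classical
      have hsum : ∀ u : Framework E, u.support ⊆ v.support ∪ w.support →
          (u.sum fun e c => |c| * ‖e.2 - e.1‖ ^ 2) =
            ∑ e ∈ v.support ∪ w.support, |u e| * ‖e.2 - e.1‖ ^ 2 := fun u hu =>
        Finsupp.sum_of_support_subset _ hu _ (by simp)
      rw [hsum _ Finsupp.support_add, hsum v Finset.subset_union_left,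
        hsum w Finset.subset_union_right, ← Finset.sum_add_distrib]
      refine Finset.sum_le_sum fun e _ => ?_
      rw [← add_mul, Finsupp.add_apply]
      gcongr
      exact abs_add_le _ _)
    (fun a w => by
      rw [Finsupp.sum_smul_index' (by simp), Finsupp.sum, Finsupp.sum, Finset.mul_sum]
      simp only [smul_eq_mul, abs_mul, mul_assoc, Real.norm_eq_abs])

theorem mass_apply (w : Framework E) : mass w = w.sum fun e c => |c| * ‖e.2 - e.1‖ ^ 2 :=
  rfl

theorem mass_single (e : E × E) (c : ℝ) : mass (Finsupp.single e c) = |c| * ‖e.2 - e.1‖ ^ 2 := by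
  rw [mass_apply, Finsupp.sum_single_index (by simp)]

variable [InnerProductSpace ℝ E]

/-- The forces at the endpoints of a bar of unit force density. -/
noncomputable def barForce (e : E × E) : E →₀ E :=
  Finsupp.single e.2 (e.2 - e.1) - Finsupp.single e.1 (e.2 - e.1)

/-- The forces exerted by a framework. -/
noncomputable def boundary : Framework E →ₗ[ℝ] E →₀ E :=
  Finsupp.linearCombination ℝ barForce

theorem boundary_single (e : E × E) (c : ℝ) : boundary (Finsupp.single e c) = c • barForce e :=
  Finsupp.linearCombination_single ℝ c e

end Framework

variable [InnerProductSpace ℝ E] [FiniteDimensional ℝ E]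

/-- The vector field representing, by the inner product, a linear functional on finite systems of
pointed vectors. -/
noncomputable def fieldOf (L : (E →₀ E) →ₗ[ℝ] ℝ) (x : E) : E :=
  (InnerProductSpace.toDual ℝ E).symm (LinearMap.toContinuousLinearMap (L ∘ₗ Finsupp.lsingle x))

theorem inner_fieldOf (L : (E →₀ E) →ₗ[ℝ] ℝ) (x v : E) :
    ⟪fieldOf L x, v⟫_ℝ = L (Finsupp.single x v) :=
  InnerProductSpace.toDual_symm_apply

theorem apply_barForce (L : (E →₀ E) →ₗ[ℝ] ℝ) (x y : E) :
    L (Framework.barForce (y, x)) = ⟪fieldOf L x - fieldOf L y, x - y⟫_ℝ := by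
  rw [Framework.barForce, map_sub, inner_sub_left, inner_fieldOf, inner_fieldOf]

theorem apply_sum_single (L : (E →₀ E) →ₗ[ℝ] ℝ) {ι : Type*} [Fintype ι] (M F : ι → E) :
    L (∑ i, Finsupp.single (M i) (F i)) = ∑ i, ⟪F i, fieldOf L (M i)⟫_ℝ := by
  simp only [map_sum, ← inner_fieldOf, real_inner_comm (fieldOf L _)]

theorem isDualField_fieldOf {L : (E →₀ E) →ₗ[ℝ] ℝ}
    (hL : ∀ w, L (Framework.boundary w) ≤ Framework.mass w) : IsDualField (fieldOf L) := by
  intro x y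
  have hpos := hL (Finsupp.single (y, x) 1)
  have hneg := hL (Finsupp.single (y, x) (-1))
  rw [Framework.boundary_single, map_smul, apply_barForce, Framework.mass_single] at hpos hneg
  simp only [abs_neg, abs_one, one_mul, neg_smul, one_smul] at hpos hneg
  exact abs_le'.2 ⟨hpos, hneg⟩

theorem mem_range_boundary {ι : Type*} [Fintype ι] {M F : ι → E}
    (h : ∀ φ : E → E, (∀ x y, ⟪φ x - φ y, x - y⟫_ℝ = 0) → ∑ i, ⟪F i, φ (M i)⟫_ℝ = 0) :
    ∑ i, Finsupp.single (M i) (F i) ∈ LinearMap.range (Framework.boundary (E := E)) := by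
  by_contra hG
  obtain ⟨L, hLG, hL⟩ := Submodule.exists_le_ker_of_notMem hG
  refine hLG ?_
  rw [apply_sum_single]
  refine h _ fun x y => ?_
  rw [← apply_barForce]
  exact hL ⟨Finsupp.single (y, x) 1, by rw [Framework.boundary_single, one_smul]⟩

theorem exists_isDualField {ι : Type*} [Fintype ι] {M F : ι → E} {m : ℝ}
    (h : ∀ φ : E → E, (∀ x y, ⟪φ x - φ y, x - y⟫_ℝ = 0) → ∑ i, ⟪F i, φ (M i)⟫_ℝ = 0)
    (hm : ∀ w : Framework E, w.boundary = ∑ i, Finsupp.single (M i) (F i) → m ≤ w.mass) :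
    ∃ φ : E → E, IsDualField φ ∧ m ≤ ∑ i, ⟪F i, φ (M i)⟫_ℝ := by
  obtain ⟨L, hL, hLm⟩ := exists_linearMap_le_seminorm_of_forall_le Framework.boundary
    Framework.mass (mem_range_boundary h) hm
  exact ⟨fieldOf L, isDualField_fieldOf hL, hLm.trans_eq (apply_sum_single L M F)⟩

end Framework

theorem exists_eq_rotation_of_inner_sub_eq_zero {φ : Plane → Plane}
    (hφ : ∀ x y, ⟪φ x - φ y, x - y⟫_ℝ = 0) :
    ∃ θ : ℝ, ∀ x, φ x 0 = φ 0 0 - θ * x 1 ∧ φ x 1 = φ 0 1 + θ * x 0 := by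
  have hskew : ∀ x y, ⟪φ x - φ 0, y⟫_ℝ + ⟪φ y - φ 0, x⟫_ℝ = 0 := by
    intro x y
    have hxy := hφ x y
    have hx := hφ x 0
    have hy := hφ y 0
    simp only [inner_sub_left, inner_sub_right, inner_zero_right] at hxy hx hy ⊢
    linarith
  let e : Fin 2 → Plane := fun i => EuclideanSpace.single i 1
  have hcoord : ∀ x i, φ x i = φ 0 i -
      ((φ (e i) 0 - φ 0 0) * x 0 + (φ (e i) 1 - φ 0 1) * x 1) := by
    intro x i
    have h := hskew x (e i)
    rw [EuclideanSpace.inner_single_right, PiLp.inner_apply, Fin.sum_univ_two] at h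
    simp only [PiLp.sub_apply, RCLike.inner_apply, conj_trivial, one_mul] at h
    linarith
  have h₀₀ : φ (e 0) 0 = φ 0 0 := by
    have h := hcoord (e 0) 0
    simp only [e, Fin.isValue, PiLp.single_eq_same, mul_one, ne_eq, one_ne_zero,
      not_false_eq_true, PiLp.single_eq_of_ne, mul_zero, add_zero] at h ⊢
    linarith
  have h₁₁ : φ (e 1) 1 = φ 0 1 := by
    have h := hcoord (e 1) 1
    simp only [e, Fin.isValue, ne_eq, zero_ne_one, not_false_eq_true, PiLp.single_eq_of_ne,
      mul_zero, PiLp.single_eq_same, mul_one, zero_add] at h ⊢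
    linarith
  have h₀₁ : φ (e 0) 1 - φ 0 1 = -(φ (e 1) 0 - φ 0 0) := by
    have h := hcoord (e 0) 1
    simp only [e, Fin.isValue, PiLp.single_eq_same, mul_one, ne_eq, one_ne_zero,
      not_false_eq_true, PiLp.single_eq_of_ne, mul_zero, add_zero, neg_sub] at h ⊢
    linarith
  refine ⟨φ (e 0) 1 - φ 0 1, fun x => ⟨?_, ?_⟩⟩
  · rw [hcoord x 0, h₀₀]
    ring
  · rw [hcoord x 1, h₁₁, h₀₁]
    ring

theorem IsEquilibrium.sum_inner_eq_zero {ι : Type*} [Fintype ι] {M F : ι → Plane}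
    (hF : IsEquilibrium M F) {φ : Plane → Plane} (hφ : ∀ x y, ⟪φ x - φ y, x - y⟫_ℝ = 0) :
    ∑ i, ⟪F i, φ (M i)⟫_ℝ = 0 := by
  obtain ⟨θ, hθ⟩ := exists_eq_rotation_of_inner_sub_eq_zero hφ
  calc ∑ i, ⟪F i, φ (M i)⟫_ℝ
      = ∑ i, (⟪F i, φ 0⟫_ℝ - θ * (F i 0 * M i 1 - F i 1 * M i 0)) := by
        refine Finset.sum_congr rfl fun i _ => ?_
        simp only [PiLp.inner_apply, Fin.sum_univ_two, RCLike.inner_apply, conj_trivial,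
          (hθ (M i)).1, (hθ (M i)).2]
        ring
    _ = 0 := by
        rw [Finset.sum_sub_distrib, ← sum_inner, ← Finset.mul_sum, hF.1, hF.2, inner_zero_left,
          mul_zero, sub_zero]

/-- The spring on a nondegenerate bar of force density `c`. -/
noncomputable def Spring.ofBar (e : Plane × Plane) (he : e.1 ≠ e.2) (c : ℝ) : Spring :=
  ⟨e.1, e.2, he, c * ‖e.2 - e.1‖⟩

theorem Spring.boundaryForce_ofBar (e : Plane × Plane) (he : e.1 ≠ e.2) (c : ℝ) (x : Plane) :
    (ofBar e he c).boundaryForce x = c • Framework.barForce e x := by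
  classical
  have hne : ‖e.2 - e.1‖ ≠ 0 := norm_ne_zero_iff.2 (sub_ne_zero.2 he.symm)
  simp only [boundaryForce, ofBar, dir, Framework.barForce, Finsupp.sub_apply,
    Finsupp.single_apply, smul_sub, smul_ite, smul_zero, smul_smul, mul_inv_cancel_right₀ hne,
    eq_comm (a := x)]

theorem Framework.exists_springs (w : Framework Plane) : ∃ (n : ℕ) (P : Fin n → Spring),
    springMass P = w.mass ∧ ∀ x, ∑ k, (P k).boundaryForce x = w.boundary x := by
  classical
  let s := w.support.filter fun e => e.1 ≠ e.2
  let idx := s.equivFin.symm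
  have hne : ∀ e : s, e.1.1 ≠ e.1.2 := fun e => (Finset.mem_filter.1 e.2).2
  have hsum : ∀ {V : Type} [AddCommMonoid V] (f : Plane × Plane → V), (∀ y, f (y, y) = 0) →
      ∑ k, f (idx k) = ∑ e ∈ w.support, f e := by
    intro V _ f hf
    rw [idx.sum_comp fun e : s => f e, Finset.sum_coe_sort s f]
    refine Finset.sum_filter_of_ne fun e _ hfe he => hfe ?_
    rw [← Prod.eta e, he, hf]
  refine ⟨_, fun k => .ofBar (idx k) (hne _) (w (idx k)), ?_, fun x => ?_⟩
  · rw [mass_apply, Finsupp.sum, ← hsum _ (by simp)]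
    refine Finset.sum_congr rfl fun k _ => ?_
    simp only [Spring.ofBar, abs_mul, abs_norm, dist_comm (idx k).1.1, dist_eq_norm]
    ring
  · simp only [Spring.boundaryForce_ofBar]
    rw [boundary, Finsupp.linearCombination_apply, Finsupp.sum, Finsupp.finsetSum_apply,
      hsum (fun e => w e • barForce e x) (by simp [barForce])]
    rfl

theorem IsEquilibrium.exists_isDualField {ι : Type*} [Fintype ι] {M F : ι → Plane}
    (hF : IsEquilibrium M F) {m : ℝ}
    (hm : ∀ (n : ℕ) (P : Fin n → Spring), SpringBoundaryEq P M F → m ≤ springMass P) :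
    ∃ φ, IsDualField φ ∧ m ≤ ∑ i, ⟪F i, φ (M i)⟫_ℝ := by
  classical
  refine _root_.exists_isDualField (fun φ hφ => hF.sum_inner_eq_zero hφ) fun w hw => ?_
  obtain ⟨n, P, hmass, hforce⟩ := w.exists_springs
  refine (hm n P fun x => ?_).trans_eq hmass
  simp only [hforce, hw, Finsupp.finsetSum_apply, Finsupp.single_apply]

/-! ### Work and mass densities -/

section Pairing

variable {n : Type*} [Fintype n] [DecidableEq n]

/-- The Frobenius pairing `∑ i j, A i j * (B eⱼ) i` of a matrix with a linear map. For a stress `A`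
and the derivative `B` of a displacement field, it is the density of work. -/
noncomputable def pairing (A : Matrix n n ℝ)
    (B : EuclideanSpace ℝ n →L[ℝ] EuclideanSpace ℝ n) : ℝ :=
  ∑ i, ∑ j, A i j * (B (EuclideanSpace.single j 1)) i

variable (B : EuclideanSpace ℝ n →L[ℝ] EuclideanSpace ℝ n)

theorem pairing_smul_vecMulVec (c : ℝ) (v : EuclideanSpace ℝ n) :
    pairing (c • Matrix.vecMulVec v v) B = c * ⟪B v, v⟫_ℝ := by
  have hv : B v = ∑ j, v j • B (EuclideanSpace.single j 1) := by
    conv_lhs => rw [← (EuclideanSpace.basisFun n ℝ).sum_repr v]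
    simp
  simp only [pairing, hv, sum_inner, PiLp.inner_apply, PiLp.smul_apply, RCLike.inner_apply,
    conj_trivial, Finset.mul_sum, Matrix.smul_apply, Matrix.vecMulVec_apply, smul_eq_mul]
  rw [Finset.sum_comm]
  exact Finset.sum_congr rfl fun j _ => Finset.sum_congr rfl fun i _ => by ring

theorem pairing_sum {κ : Type*} [Fintype κ] (A : κ → Matrix n n ℝ) :
    pairing (∑ k, A k) B = ∑ k, pairing (A k) B := by
  simp only [pairing, Matrix.sum_apply, Finset.sum_mul]
  conv_rhs => rw [Finset.sum_comm]
  exact Finset.sum_congr rfl fun i _ => Finset.sum_comm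

theorem eq_sum_eigenvalues_smul_vecMulVec {A : Matrix n n ℝ} (hA : A.IsHermitian) :
    A = ∑ k, hA.eigenvalues k •
      Matrix.vecMulVec (hA.eigenvectorBasis k) (hA.eigenvectorBasis k) := by
  ext i j
  conv_lhs => rw [hA.spectral_theorem]
  simp only [RCLike.ofReal_real_eq_id, CompTriple.comp_eq, Unitary.conjStarAlgAut_apply,
    Matrix.star_eq_conjTranspose, Matrix.conjTranspose_eq_transpose_of_trivial, Matrix.mul_apply,
    Matrix.IsHermitian.eigenvectorUnitary_apply, Matrix.diagonal_apply, mul_ite, mul_zero,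
    Finset.sum_ite_eq', Finset.mem_univ, ↓reduceIte, Matrix.transpose_apply, Matrix.sum_apply,
    Matrix.smul_apply, Matrix.vecMulVec_apply, smul_eq_mul]
  exact Finset.sum_congr rfl fun k _ => by ring

variable {B}

theorem pairing_le_sum_abs_eigenvalues {A : Matrix n n ℝ} (hA : A.IsHermitian)
    (hB : ∀ w, |⟪B w, w⟫_ℝ| ≤ ‖w‖ ^ 2) : pairing A B ≤ ∑ k, |hA.eigenvalues k| := by
  calc pairing A B
      = ∑ k, hA.eigenvalues k * ⟪B (hA.eigenvectorBasis k), hA.eigenvectorBasis k⟫_ℝ := by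
        conv_lhs => rw [eq_sum_eigenvalues_smul_vecMulVec hA]
        simp only [pairing_sum, pairing_smul_vecMulVec]
    _ ≤ ∑ k, |hA.eigenvalues k| := Finset.sum_le_sum fun k _ => by
        refine (le_abs_self _).trans ?_
        rw [abs_mul]
        refine mul_le_of_le_one_right (abs_nonneg _) ((hB _).trans_eq ?_)
        rw [hA.eigenvectorBasis.norm_eq_one, one_pow]

theorem integral_pairing {α : Type*} [MeasurableSpace α] {μ : Measure α} {A : α → Matrix n n ℝ}
    {B : α → EuclideanSpace ℝ n →L[ℝ] EuclideanSpace ℝ n}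
    (h : ∀ i j, Integrable (fun x => A x i j * (B x (EuclideanSpace.single j 1)) i) μ) :
    ∫ x, pairing (A x) (B x) ∂μ
      = ∑ i, ∑ j, ∫ x, A x i j * (B x (EuclideanSpace.single j 1)) i ∂μ := by
  simp only [pairing]
  rw [integral_finsetSum _ fun i _ => integrable_finsetSum _ fun j _ => h i j]
  exact Finset.sum_congr rfl fun i _ => integral_finsetSum _ fun j _ => h i j

end Pairing

section MatrixCost

variable {A : Matrix (Fin 2) (Fin 2) ℝ}

/-- Read off from trace and determinant through `|a| + |b| = max |a + b| |a - b|`. -/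
theorem matrixCost_eq (hA : A.IsHermitian) :
    matrixCost hA = max |A 0 0 + A 1 1| √((A 0 0 - A 1 1) ^ 2 + (2 * A 0 1) ^ 2) := by
  have habs : ∀ a b : ℝ, |a| + |b| = max |a + b| |a - b| := by grind
  have hsymm : A 1 0 = A 0 1 := by simpa using hA.apply 0 1
  have htrace := hA.trace_eq_sum_eigenvalues
  have hdet := hA.det_eq_prod_eigenvalues
  simp only [Matrix.trace_fin_two, Matrix.det_fin_two, Fin.sum_univ_two, Fin.prod_univ_two,
    RCLike.ofReal_real_eq_id, id_eq, hsymm] at htrace hdet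
  rw [matrixCost, Fin.sum_univ_two, habs, htrace, ← Real.sqrt_sq_eq_abs (_ - _)]
  congr 2
  linear_combination
    4 * hdet - (A 0 0 + A 1 1 + hA.eigenvalues 0 + hA.eigenvalues 1) * htrace

theorem matrixCost_nonneg (hA : A.IsHermitian) : 0 ≤ matrixCost hA :=
  Finset.sum_nonneg fun _ _ => abs_nonneg _

theorem matrixCost_le (hA : A.IsHermitian) :
    matrixCost hA ≤ |A 0 0| + |A 1 1| + |2 * A 0 1| := by
  rw [matrixCost_eq]
  refine max_le ((abs_add_le _ _).trans (le_add_of_nonneg_right (abs_nonneg _))) ?_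
  calc √((A 0 0 - A 1 1) ^ 2 + (2 * A 0 1) ^ 2)
      ≤ |A 0 0 - A 1 1| + |2 * A 0 1| := Real.sqrt_le_iff.2 ⟨by positivity, by
        rw [add_sq, sq_abs, sq_abs]
        linarith [mul_nonneg (abs_nonneg (A 0 0 - A 1 1)) (abs_nonneg (2 * A 0 1))]⟩
    _ ≤ _ := by
      gcongr
      exact abs_sub _ _

end MatrixCost

section Integration

/-- Pass to Radon–Nikodym densities with respect to `μ + ∑ k, ν k`. -/
theorem integral_mul_eq_sum_of_forall_setIntegral_eq {α κ : Type*} [MeasurableSpace α] [Fintype κ]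
    {μ : Measure α} [IsFiniteMeasure μ] {ν : κ → Measure α} [∀ k, IsFiniteMeasure (ν k)]
    {f g : α → ℝ} {c : κ → ℝ} (hf : Integrable f μ) (hg : ∀ k, Integrable g (ν k))
    (h : ∀ s, MeasurableSet s → ∫ x in s, f x ∂μ = ∑ k, c k * (ν k).real s) :
    ∫ x, f x * g x ∂μ = ∑ k, c k * ∫ x, g x ∂ν k := by
  set m := μ + ∑ k, ν k
  have hμ : μ ≪ m := Measure.AbsolutelyContinuous.rfl.add_right _
  have hν : ∀ k, ν k ≪ m := fun k => Measure.absolutelyContinuous_of_le <|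
    Measure.le_add_left <|
      Finset.single_le_sum (fun k _ => Measure.zero_le (ν k)) (Finset.mem_univ k)
  have hdensity : (fun x => (μ.rnDeriv m x).toReal • f x)
      =ᵐ[m] fun x => ∑ k, c k * ((ν k).rnDeriv m x).toReal := by
    refine Integrable.ae_eq_of_forall_setIntegral_eq _ _ ((integrable_rnDeriv_smul_iff hμ).2 hf)
      (integrable_finsetSum _ fun k _ => Measure.integrable_toReal_rnDeriv.const_mul _)
      fun s hs _ => ?_
    rw [setIntegral_rnDeriv_smul hμ hs, h s hs, integral_finsetSum _ fun k _ =>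
      (Measure.integrable_toReal_rnDeriv.const_mul _).integrableOn]
    simp only [integral_const_mul, Measure.setIntegral_toReal_rnDeriv (hν _)]
  calc ∫ x, f x * g x ∂μ
      = ∫ x, (μ.rnDeriv m x).toReal • (f x * g x) ∂m := (integral_rnDeriv_smul hμ).symm
    _ = ∫ x, ∑ k, c k * (((ν k).rnDeriv m x).toReal • g x) ∂m := by
        refine integral_congr_ae (hdensity.mono fun x hx => ?_)
        simp only [smul_eq_mul] at hx ⊢
        rw [← mul_assoc, hx, Finset.sum_mul]
        simp only [mul_assoc]
    _ = ∑ k, c k * ∫ x, g x ∂ν k := by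
        rw [integral_finsetSum _ fun k _ =>
          ((integrable_rnDeriv_smul_iff (hν k)).2 (hg k)).const_mul _]
        simp only [integral_const_mul, integral_rnDeriv_smul (hν _)]

theorem integrable_mul_of_isCompact {X : Type*} [TopologicalSpace X] [T2Space X]
    [SecondCountableTopology X] [MeasurableSpace X] [BorelSpace X] {μ : Measure X}
    {K : Set X} (hK : IsCompact K) (hμK : μ Kᶜ = 0) {f g : X → ℝ} (hf : Integrable f μ)
    (hg : Continuous g) :
    Integrable (fun x => f x * g x) μ := by
  rw [← Measure.restrict_eq_self_of_ae_mem (mem_ae_iff.2 hμK)]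
  exact hf.integrableOn.mul_continuousOn hg.continuousOn hK

theorem isCompact_segment {E : Type*} [AddCommGroup E] [Module ℝ E] [TopologicalSpace E]
    [IsTopologicalAddGroup E] [ContinuousSMul ℝ E] (x y : E) : IsCompact (segment ℝ x y) := by
  rw [← convexHull_pair]
  exact (Set.toFinite {x, y}).isCompact_convexHull (𝕜 := ℝ)

section Segment

variable {E : Type*} [NormedAddCommGroup E] [NormedSpace ℝ E] [MeasurableSpace E] [BorelSpace E]

theorem setIntegral_segment_add_smul {G : Type*} [NormedAddCommGroup G] [NormedSpace ℝ G]
    {v : E} (hv : ‖v‖ = 1) (a : E) {t : ℝ} (ht : 0 ≤ t) (g : E → G) :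
    ∫ x in segment ℝ a (a + t • v), g x ∂μH[1] = ∫ τ in 0..t, g (a + τ • v) := by
  have hline : Isometry fun τ : ℝ => a + τ • v := .of_dist_eq fun τ σ => by
    rw [dist_add_left, dist_eq_norm, ← sub_smul, norm_smul, hv, mul_one, ← dist_eq_norm]
  have hsegment : segment ℝ a (a + t • v) = (fun τ : ℝ => a + τ • v) '' Set.Icc 0 t := by
    have h := image_segment ℝ (AffineMap.lineMap a (a + v) : ℝ →ᵃ[ℝ] E) 0 t
    rw [segment_eq_Icc ht] at h
    simpa [AffineMap.lineMap_apply, add_comm] using h.symm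
  have hembed := hline.isClosedEmbedding.measurableEmbedding
  have hmap := hline.map_hausdorffMeasure (d := 1) (.inl zero_le_one)
  rw [hsegment, ← Measure.restrict_restrict_of_subset (Set.image_subset_range _ _), ← hmap,
    hembed.setIntegral_map, hausdorffMeasure_real, hline.injective.preimage_image,
    integral_Icc_eq_integral_Ioc, ← intervalIntegral.integral_of_le ht]

end Segment

theorem setIntegral_segment_inner_fderiv {E : Type*} [NormedAddCommGroup E] [InnerProductSpace ℝ E]
    [MeasurableSpace E] [BorelSpace E] {ψ : E → E} (hψ : ContDiff ℝ 1 ψ) {v : E} (hv : ‖v‖ = 1)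
    (a : E) {t : ℝ} (ht : 0 ≤ t) :
    ∫ x in segment ℝ a (a + t • v), ⟪fderiv ℝ ψ x v, v⟫_ℝ ∂μH[1] = ⟪ψ (a + t • v) - ψ a, v⟫_ℝ := by
  rw [setIntegral_segment_add_smul hv a ht]
  have hderiv : ∀ τ ∈ Set.uIcc 0 t, HasDerivAt (fun τ : ℝ => ⟪ψ (a + τ • v), v⟫_ℝ)
      ⟪fderiv ℝ ψ (a + τ • v) v, v⟫_ℝ τ := fun τ _ => by
    have hline : HasDerivAt (fun τ : ℝ => a + τ • v) v τ := by
      simpa using ((hasDerivAt_id τ).smul_const v).const_add a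
    have h := (hψ.differentiable one_ne_zero _).hasFDerivAt.comp_hasDerivAt τ hline
    simpa using h.inner ℝ (hasDerivAt_const τ v)
  have hcont : Continuous fun τ : ℝ => ⟪fderiv ℝ ψ (a + τ • v) v, v⟫_ℝ :=
    (((hψ.continuous_fderiv one_ne_zero).comp (by fun_prop)).clm_apply continuous_const).inner
      continuous_const
  rw [intervalIntegral.integral_eq_sub_of_hasDerivAt hderiv (hcont.intervalIntegrable _ _)]
  simp [inner_sub_left]

theorem exists_contDiff_tsupport_subset_eq_ite {E : Type*} [NormedAddCommGroup E]
    [NormedSpace ℝ E] [FiniteDimensional ℝ E] [DecidableEq E] {p : E} {U Z : Set E} (hU : U ∈ 𝓝 p)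
    (hZ : Z.Finite) : ∃ χ : E → ℝ, ContDiff ℝ ∞ χ ∧ tsupport χ ⊆ U ∧
      ∀ z ∈ Z, χ z = if p = z then 1 else 0 := by
  have hV : U ∩ (Z \ {p})ᶜ ∈ 𝓝 p :=
    Filter.inter_mem hU (hZ.sdiff.isClosed.isOpen_compl.mem_nhds (by simp))
  obtain ⟨χ, hsupport, -, hχ, -, hχp⟩ := exists_contDiff_tsupport_subset (n := ⊤) hV
  refine ⟨χ, hχ, hsupport.trans Set.inter_subset_left, fun z hz => ?_⟩
  split_ifs with hpz
  · rw [← hpz, hχp]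
  · exact image_eq_zero_of_notMem_tsupport fun h => (hsupport h).2 ⟨hz, Ne.symm hpz⟩

theorem exists_hasCompactSupport_eventuallyEq {E G : Type*} [NormedAddCommGroup E]
    [InnerProductSpace ℝ E] [FiniteDimensional ℝ E] [NormedAddCommGroup G] [NormedSpace ℝ G]
    {K : Set E} (hK : Bornology.IsBounded K) {ψ : E → G} (hψ : ContDiff ℝ ∞ ψ) :
    ∃ ψ' : E → G, ContDiff ℝ ∞ ψ' ∧ HasCompactSupport ψ' ∧ ∀ x ∈ K, ψ' =ᶠ[𝓝 x] ψ := by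
  obtain ⟨R, hR, hKR⟩ := hK.subset_ball_lt 0 0
  let η : ContDiffBump (0 : E) := ⟨R, R + 1, hR, lt_add_one R⟩
  refine ⟨fun x => η x • ψ x, η.contDiff.smul hψ, η.hasCompactSupport.smul_right, fun x hx => ?_⟩
  filter_upwards [η.eventuallyEq_one_of_mem_ball (hKR hx)] with y hy
  rw [hy, Pi.one_apply, one_smul]

end Integration

namespace Spring

variable {s : Spring} {p v : Plane}

theorem length_pos (s : Spring) : 0 < ‖s.b - s.a‖ :=
  norm_pos_iff.2 (sub_ne_zero.2 s.ne.symm)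

theorem norm_dir (s : Spring) : ‖s.dir‖ = 1 :=
  norm_smul_inv_norm (sub_ne_zero.2 s.ne.symm)

theorem length_smul_dir (s : Spring) : ‖s.b - s.a‖ • s.dir = s.b - s.a :=
  smul_inv_smul₀ s.length_pos.ne' _

theorem isCompact_carrier (s : Spring) : IsCompact s.carrier :=
  isCompact_segment _ _

theorem hausdorffMeasure_carrier_lt_top (s : Spring) : μH[1] s.carrier < ⊤ := by
  rw [carrier, hausdorffMeasure_segment]
  exact edist_lt_top _ _

theorem integral_carrier_inner_fderiv (s : Spring) {ψ : Plane → Plane} (hψ : ContDiff ℝ 1 ψ) :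
    ∫ x in s.carrier, ⟪fderiv ℝ ψ x s.dir, s.dir⟫_ℝ ∂μH[1] = ⟪ψ s.b - ψ s.a, s.dir⟫_ℝ := by
  have hb : s.b = s.a + ‖s.b - s.a‖ • s.dir := by rw [length_smul_dir, add_sub_cancel]
  have h := setIntegral_segment_inner_fderiv hψ s.norm_dir s.a (norm_nonneg (s.b - s.a))
  rwa [← hb] at h

open Classical in
/-- The unit vectors along the spring `s` pointing from `p ∈ s.carrier` into `s`: one if `p` is an
endpoint, two opposite ones otherwise. -/
noncomputable def branchDirs (s : Spring) (p : Plane) : Finset Plane :=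
  (if p = s.b then ∅ else {s.dir}) ∪ (if p = s.a then ∅ else {-s.dir})

theorem mem_branchDirs : v ∈ s.branchDirs p ↔ p ≠ s.b ∧ v = s.dir ∨ p ≠ s.a ∧ v = -s.dir := by
  rw [branchDirs, Finset.mem_union]
  exact or_congr (by split_ifs with hb <;> simp [hb]) (by split_ifs with ha <;> simp [ha])

theorem eq_or_eq_neg_of_mem_branchDirs (hv : v ∈ s.branchDirs p) : v = s.dir ∨ v = -s.dir :=
  (mem_branchDirs.1 hv).imp And.right And.right

theorem norm_of_mem_branchDirs (hv : v ∈ s.branchDirs p) : ‖v‖ = 1 := by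
  rcases eq_or_eq_neg_of_mem_branchDirs hv with rfl | rfl
  · exact s.norm_dir
  · rw [norm_neg, norm_dir]

theorem branchDirs_nonempty (s : Spring) (p : Plane) : (s.branchDirs p).Nonempty := by
  by_cases hb : p = s.b
  · exact ⟨-s.dir, mem_branchDirs.2 (.inr ⟨hb ▸ s.ne.symm, rfl⟩)⟩
  · exact ⟨s.dir, mem_branchDirs.2 (.inl ⟨hb, rfl⟩)⟩

theorem boundaryForce_eq_neg_smul_sum_branchDirs (s : Spring) (p : Plane) :
    s.boundaryForce p = -(s.coeff • ∑ v ∈ s.branchDirs p, v) := by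
  have _ : IsAddTorsionFree Plane := .of_module_rat _
  have hne : s.dir ≠ -s.dir := self_ne_neg.2 (norm_ne_zero_iff.1 (s.norm_dir ▸ one_ne_zero))
  unfold boundaryForce branchDirs
  split_ifs with hb ha
  · exact absurd (ha.symm.trans hb) s.ne
  · simp
  · simp
  · simp [hne]

theorem exists_segment_subset_carrier (hp : p ∈ s.carrier) (hv : v ∈ s.branchDirs p) :
    ∃ η > (0 : ℝ), ∀ t ∈ Set.Icc 0 η, segment ℝ p (p + t • v) ⊆ s.carrier := by
  have hconvex : Convex ℝ s.carrier := convex_segment _ _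
  suffices h : ∃ η > (0 : ℝ), p + η • v ∈ s.carrier by
    obtain ⟨η, hη, hmem⟩ := h
    refine ⟨η, hη, fun t ht => hconvex.segment_subset hp ?_⟩
    have h := (hconvex.starConvex hp).add_smul_mem hmem (div_nonneg ht.1 hη.le)
      (div_le_one_of_le₀ ht.2 hη.le)
    rwa [smul_smul, div_mul_cancel₀ _ hη.ne'] at h
  have hp' := hp
  rw [carrier, segment_eq_image'] at hp'
  obtain ⟨θ, ⟨hθ₀, hθ₁⟩, rfl⟩ := hp'
  rcases mem_branchDirs.1 hv with ⟨hb, rfl⟩ | ⟨ha, rfl⟩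
  · have hθ : θ < 1 := hθ₁.lt_of_ne (by rintro rfl; simp at hb)
    refine ⟨(1 - θ) * ‖s.b - s.a‖, mul_pos (sub_pos.2 hθ) s.length_pos, ?_⟩
    rw [mul_smul, length_smul_dir, add_assoc, ← add_smul, add_sub_cancel, one_smul,
      add_sub_cancel]
    exact right_mem_segment ℝ _ _
  · have hθ : 0 < θ := hθ₀.lt_of_ne' (by rintro rfl; simp at ha)
    refine ⟨θ * ‖s.b - s.a‖, mul_pos hθ s.length_pos, ?_⟩
    rw [smul_neg, mul_smul, length_smul_dir, add_neg_cancel_right]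
    exact left_mem_segment ℝ _ _

end Spring

/-! ### Springs of a minimizer near a point -/

namespace StressMeasure

variable {T : StressMeasure} {ι κ : Type*} [Fintype ι] [Fintype κ] {M F : ι → Plane}
  {s : κ → Spring} {p : Plane} {ψ : Plane → Plane}

theorem integrable_matrixCost (T : StressMeasure) :
    Integrable (fun x => matrixCost (T.symmetric x)) T.base := by
  have h := T.integrable
  refine (((h 0 0).abs.add (h 1 1).abs).add ((h 0 1).const_mul 2).abs).mono' ?_
    (.of_forall fun x => ?_)
  · have hm := fun i j => (h i j).1.aemeasurable
    simp only [matrixCost_eq]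
    exact (((hm 0 0).add (hm 1 1)).abs.max ((((hm 0 0).sub (hm 1 1)).pow_const 2).add
      (((hm 0 1).const_mul 2).pow_const 2)).sqrt).aestronglyMeasurable
  · rw [Real.norm_of_nonneg (matrixCost_nonneg _)]
    exact matrixCost_le _

theorem continuous_fderiv_entry (hψ : ContDiff ℝ ∞ ψ) (i j : Fin 2) :
    Continuous fun x => (fderiv ℝ ψ x (EuclideanSpace.single j 1)) i := by
  have h := (hψ.continuous_fderiv (by simp)).clm_apply
    (continuous_const (y := (EuclideanSpace.single j 1 : Plane)))
  fun_prop

theorem integrable_density_mul_fderiv_entry (T : StressMeasure) (hψ : ContDiff ℝ ∞ ψ)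
    (i j i' j' : Fin 2) : Integrable
      (fun x => T.density x i j * (fderiv ℝ ψ x (EuclideanSpace.single j' 1)) i') T.base := by
  obtain ⟨K, hK, hTK⟩ := T.compactSupport
  exact integrable_mul_of_isCompact hK hTK (T.integrable i j) (continuous_fderiv_entry hψ i' j')

theorem integrable_pairing (T : StressMeasure) (hψ : ContDiff ℝ ∞ ψ) :
    Integrable (fun x => pairing (T.density x) (fderiv ℝ ψ x)) T.base :=
  integrable_finsetSum _ fun i _ => integrable_finsetSum _ fun j _ =>
    T.integrable_density_mul_fderiv_entry hψ i j i j

theorem BoundaryEq.integral_pairing (hT : T.BoundaryEq M F) (hψ : ContDiff ℝ ∞ ψ) :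
    ∫ x, pairing (T.density x) (fderiv ℝ ψ x) ∂T.base = ∑ i, ⟪F i, ψ (M i)⟫_ℝ := by
  obtain ⟨K, hK, hTK⟩ := T.compactSupport
  obtain ⟨ψ', hψ', hcompact, heq⟩ := exists_hasCompactSupport_eventuallyEq
    (hK.isBounded.union (Set.finite_range M).isBounded) hψ
  calc ∫ x, pairing (T.density x) (fderiv ℝ ψ x) ∂T.base
      = ∫ x, pairing (T.density x) (fderiv ℝ ψ' x) ∂T.base := by
        refine integral_congr_ae ?_
        filter_upwards [mem_ae_iff.2 hTK] with x hx
        rw [(heq x (.inl hx)).fderiv_eq]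
    _ = ∑ i, ⟪F i, ψ' (M i)⟫_ℝ := hT ψ' hψ' hcompact
    _ = ∑ i, ⟪F i, ψ (M i)⟫_ℝ :=
        Finset.sum_congr rfl fun i _ => by rw [(heq (M i) (.inr ⟨i, rfl⟩)).self_of_nhds]

theorem pairing_fderiv_le_matrixCost (T : StressMeasure) (hψ : ContDiff ℝ ∞ ψ)
    (hdual : IsDualField ψ) (x : Plane) :
    pairing (T.density x) (fderiv ℝ ψ x) ≤ matrixCost (T.symmetric x) :=
  pairing_le_sum_abs_eigenvalues _
    (hdual.abs_inner_fderiv_le (hψ.differentiable (by simp) x))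

theorem setIntegral_pairing_le_setIntegral_matrixCost (T : StressMeasure) (hψ : ContDiff ℝ ∞ ψ)
    (hdual : IsDualField ψ) (S : Set Plane) :
    ∫ x in S, pairing (T.density x) (fderiv ℝ ψ x) ∂T.base
      ≤ ∫ x in S, matrixCost (T.symmetric x) ∂T.base :=
  integral_mono (T.integrable_pairing hψ).integrableOn T.integrable_matrixCost.integrableOn
    (T.pairing_fderiv_le_matrixCost hψ hdual)

theorem BoundaryEq.setIntegral_matrixCost_le (hT : T.BoundaryEq M F) (hψ : ContDiff ℝ ∞ ψ)
    (hdual : IsDualField ψ) (S : Set Plane) :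
    ∫ x in S, matrixCost (T.symmetric x) ∂T.base
      ≤ ∫ x in S, pairing (T.density x) (fderiv ℝ ψ x) ∂T.base
        + (T.mass - ∑ i, ⟪F i, ψ (M i)⟫_ℝ) := by
  have hcost := T.integrable_matrixCost
  have hpairing := T.integrable_pairing hψ
  rw [← sub_le_iff_le_add', ← integral_sub hcost.integrableOn hpairing.integrableOn,
    ← hT.integral_pairing hψ, mass, ← integral_sub hcost hpairing]
  exact setIntegral_le_integral (hcost.sub hpairing)
    (.of_forall fun x => sub_nonneg.2 (T.pairing_fderiv_le_matrixCost hψ hdual x))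

/-- The measure `T` coincides in the set `U` with the sum of the stresses of the springs `s k`. -/
def EqSpringsOn (T : StressMeasure) (U : Set Plane) (s : κ → Spring) : Prop :=
  ∀ S : Set Plane, MeasurableSet S → S ⊆ U →
    ∀ i j, ∫ x in S, T.density x i j ∂T.base = ∑ k, (s k).stressOn S i j

namespace EqSpringsOn

variable {U S : Set Plane}

theorem setIntegral_pairing (h : T.EqSpringsOn U s) (hS : MeasurableSet S) (hSU : S ⊆ U)
    (hψ : ContDiff ℝ ∞ ψ) :
    ∫ x in S, pairing (T.density x) (fderiv ℝ ψ x) ∂T.base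
      = ∑ k, (s k).coeff *
          ∫ x in S ∩ (s k).carrier, ⟪fderiv ℝ ψ x (s k).dir, (s k).dir⟫_ℝ ∂μH[1] := by
  let A : κ → Matrix (Fin 2) (Fin 2) ℝ :=
    fun k => (s k).coeff • Matrix.vecMulVec (s k).dir (s k).dir
  let ν : κ → Measure Plane := fun k => μH[1].restrict (S ∩ (s k).carrier)
  have hν : ∀ k, μH[1] (S ∩ (s k).carrier) < ⊤ := fun k =>
    (measure_mono Set.inter_subset_right).trans_lt (s k).hausdorffMeasure_carrier_lt_top
  have _ : IsFiniteMeasure T.base := T.finite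
  have _ : ∀ k, IsFiniteMeasure (ν k) := fun k => ⟨by
    rw [Measure.restrict_apply_univ]; exact hν k⟩
  have hint : ∀ k i j,
      Integrable (fun x => (fderiv ℝ ψ x (EuclideanSpace.single j 1)) i) (ν k) := fun k i j =>
    (continuous_fderiv_entry hψ i j).continuousOn.integrableOn_of_subset_isCompact
      (s k).isCompact_carrier (hS.inter (s k).isCompact_carrier.measurableSet)
      Set.inter_subset_right (hν k).ne
  have hentry : ∀ i j,
      ∫ x in S, T.density x i j * (fderiv ℝ ψ x (EuclideanSpace.single j 1)) i ∂T.base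
        = ∑ k, A k i j * ∫ x, (fderiv ℝ ψ x (EuclideanSpace.single j 1)) i ∂ν k := fun i j => by
    refine integral_mul_eq_sum_of_forall_setIntegral_eq (T.integrable i j).integrableOn
      (fun k => hint k i j) fun E hE => ?_
    rw [Measure.restrict_restrict hE, h _ (hE.inter hS) (Set.inter_subset_right.trans hSU)]
    refine Finset.sum_congr rfl fun k _ => ?_
    rw [Spring.stressOn, measureReal_restrict_apply hE, Set.inter_assoc, mul_assoc (s k).coeff]
    rfl
  calc ∫ x in S, pairing (T.density x) (fderiv ℝ ψ x) ∂T.base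
      = ∑ i, ∑ j, ∑ k, ∫ x, A k i j * (fderiv ℝ ψ x (EuclideanSpace.single j 1)) i ∂ν k := by
        rw [_root_.integral_pairing fun i j =>
          (T.integrable_density_mul_fderiv_entry hψ i j i j).integrableOn]
        simp only [hentry, integral_const_mul]
    _ = ∑ k, ∫ x, pairing (A k) (fderiv ℝ ψ x) ∂ν k := by
        simp only [_root_.integral_pairing fun i j => (hint _ i j).const_mul (A _ i j)]
        exact (Finset.sum_comm.trans (Finset.sum_congr rfl fun i _ => Finset.sum_comm)).symm
    _ = ∑ k, (s k).coeff *
          ∫ x in S ∩ (s k).carrier, ⟪fderiv ℝ ψ x (s k).dir, (s k).dir⟫_ℝ ∂μH[1] := by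
        simp only [A, ν, pairing_smul_vecMulVec, integral_const_mul]

theorem integral_pairing (h : T.EqSpringsOn U s) (hU : MeasurableSet U) (hψ : ContDiff ℝ ∞ ψ)
    (hsupport : tsupport ψ ⊆ U) :
    ∫ x, pairing (T.density x) (fderiv ℝ ψ x) ∂T.base
      = ∑ k, (s k).coeff * ⟪ψ (s k).b - ψ (s k).a, (s k).dir⟫_ℝ := by
  have hzero : ∀ x ∉ U, fderiv ℝ ψ x = 0 := fun x hx =>
    fderiv_of_notMem_tsupport ℝ fun h => hx (hsupport h)
  rw [← setIntegral_eq_integral_of_forall_compl_eq_zero (s := U)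
    fun x hx => by simp [pairing, hzero x hx], h.setIntegral_pairing hU subset_rfl hψ]
  refine Finset.sum_congr rfl fun k _ => ?_
  rw [← (s k).integral_carrier_inner_fderiv (hψ.of_le (by simp)),
    setIntegral_eq_of_subset_of_forall_sdiff_eq_zero (s k).isCompact_carrier.measurableSet
      Set.inter_subset_right fun x hx => by rw [hzero x fun hU => hx.2 ⟨hU, hx.1⟩]; simp]

theorem setIntegral_segment_pairing (h : T.EqSpringsOn U s) {k : κ} {v : Plane} {t : ℝ}
    (hv : v = (s k).dir ∨ v = -(s k).dir) (ht : 0 ≤ t)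
    (hmeet : ∀ l ≠ k, (s k).carrier ∩ (s l).carrier ⊆ {p})
    (hsub : segment ℝ p (p + t • v) ⊆ (s k).carrier ∩ U) (hψ : ContDiff ℝ ∞ ψ) :
    ∫ x in segment ℝ p (p + t • v), pairing (T.density x) (fderiv ℝ ψ x) ∂T.base
      = (s k).coeff * ⟪ψ (p + t • v) - ψ p, v⟫_ℝ := by
  have hsubk := hsub.trans Set.inter_subset_left
  have hv1 : ‖v‖ = 1 := by rcases hv with rfl | rfl <;> simp [(s k).norm_dir]
  have hnull : ∀ l ≠ k, μH[1] (segment ℝ p (p + t • v) ∩ (s l).carrier) = 0 := fun l hl =>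
    measure_mono_null ((Set.inter_subset_inter_left _ hsubk).trans (hmeet l hl))
      (by rw [← segment_same ℝ p, hausdorffMeasure_segment, edist_self])
  rw [h.setIntegral_pairing (isCompact_segment _ _).measurableSet
    (hsub.trans Set.inter_subset_right) hψ,
    Finset.sum_eq_single k]
  · rw [Set.inter_eq_left.2 hsubk,
      ← setIntegral_segment_inner_fderiv (hψ.of_le (by simp)) hv1 p ht]
    rcases hv with rfl | rfl <;> simp
  · intro l _ hl
    rw [setIntegral_measure_zero _ (hnull l hl), mul_zero]
  · simp

end EqSpringsOn

namespace IsSpringsNear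

variable {k : κ} {v : Plane}

theorem sum_boundaryForce_eq_zero (hs : T.IsSpringsNear p s) (hT : T.BoundaryEq M F)
    (hp : ∀ i, M i ≠ p) : ∑ k, (s k).boundaryForce p = 0 := by
  obtain ⟨-, -, r, hr, h⟩ := hs
  obtain ⟨χ, hχ, hsupport, hχZ⟩ := exists_contDiff_tsupport_subset_eq_ite
    (Metric.ball_mem_nhds p hr) ((Set.finite_range M).union
      ((Set.finite_range fun k => (s k).a).union (Set.finite_range fun k => (s k).b)))
  set w := ∑ k, (s k).boundaryForce p with hw
  have hψ : ContDiff ℝ ∞ fun x => χ x • w := hχ.smul contDiff_const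
  have hforce : ∀ k, (s k).coeff * ⟪χ (s k).b • w - χ (s k).a • w, (s k).dir⟫_ℝ
      = ⟪w, (s k).boundaryForce p⟫_ℝ := fun k => by
    rw [Spring.boundaryForce, hχZ _ (.inr (.inl ⟨k, rfl⟩)), hχZ _ (.inr (.inr ⟨k, rfl⟩))]
    split_ifs <;> simp [inner_smul_right]
  have hwork := EqSpringsOn.integral_pairing h measurableSet_ball hψ
    ((tsupport_smul_subset_left _ _).trans hsupport)
  rw [hT.integral_pairing hψ] at hwork
  simp only [hforce, ← inner_sum, ← hw] at hwork
  rw [← inner_self_eq_zero (𝕜 := ℝ), ← hwork]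
  refine Finset.sum_eq_zero fun i _ => ?_
  rw [hχZ _ (.inl ⟨i, rfl⟩), if_neg (hp i).symm, zero_smul, inner_zero_right]

theorem exists_setIntegral_segment_pairing (hs : T.IsSpringsNear p s)
    (hv : v ∈ (s k).branchDirs p) :
    ∃ η > (0 : ℝ), ∀ t ∈ Set.Icc 0 η, ∀ ψ : Plane → Plane, ContDiff ℝ ∞ ψ →
      ∫ x in segment ℝ p (p + t • v), pairing (T.density x) (fderiv ℝ ψ x) ∂T.base
        = (s k).coeff * ⟪ψ (p + t • v) - ψ p, v⟫_ℝ := by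
  obtain ⟨hps, hmeet, r, hr, h⟩ := hs
  obtain ⟨η, hη, hη_sub⟩ := Spring.exists_segment_subset_carrier (hps k) hv
  refine ⟨min η (r / 2), lt_min hη (half_pos hr), fun t ht ψ hψ =>
    EqSpringsOn.setIntegral_segment_pairing h (Spring.eq_or_eq_neg_of_mem_branchDirs hv) ht.1
      (fun l hl => (hmeet k l hl.symm).subset)
      (Set.subset_inter (hη_sub t ⟨ht.1, ht.2.trans (min_le_left _ _)⟩)
        ((convex_ball p r).segment_subset (Metric.mem_ball_self hr) ?_)) hψ⟩
  rw [mem_ball_iff_norm, add_sub_cancel_left, norm_smul, Spring.norm_of_mem_branchDirs hv, mul_one,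
    Real.norm_of_nonneg ht.1]
  exact (ht.2.trans (min_le_right _ _)).trans_lt (half_lt_self hr)

theorem exists_abs_coeff_mul_le (hs : T.IsSpringsNear p s) (hT : T.BoundaryEq M F)
    {φ : Plane → Plane} (hφ : IsDualField φ) (hopt : T.mass ≤ ∑ i, ⟪F i, φ (M i)⟫_ℝ)
    (hv : v ∈ (s k).branchDirs p) :
    ∃ η > (0 : ℝ), ∀ t ∈ Set.Icc 0 η,
      |(s k).coeff| * t ≤ (s k).coeff * ⟪φ (p + t • v) - φ p, v⟫_ℝ := by
  obtain ⟨η, hη, hwork⟩ := hs.exists_setIntegral_segment_pairing hv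
  refine ⟨η, hη, fun t ht => ?_⟩
  have hcost : |(s k).coeff| * t
      ≤ ∫ x in segment ℝ p (p + t • v), matrixCost (T.symmetric x) ∂T.base := by
    have hid := T.setIntegral_pairing_le_setIntegral_matrixCost contDiff_id IsDualField.id
      (segment ℝ p (p + t • v))
    have hneg := T.setIntegral_pairing_le_setIntegral_matrixCost contDiff_id.neg
      IsDualField.id.neg (segment ℝ p (p + t • v))
    have hvv : ⟪v, v⟫_ℝ = 1 := by
      rw [real_inner_self_eq_norm_sq, Spring.norm_of_mem_branchDirs hv, one_pow]
    rw [hwork t ht _ contDiff_id] at hid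
    rw [hwork t ht _ contDiff_id.neg] at hneg
    simp only [id, neg_sub_neg, add_sub_cancel_left, sub_add_cancel_left,
      inner_neg_left, real_inner_smul_left, hvv, mul_one, mul_neg] at hid hneg
    rcases abs_choice (s k).coeff with h | h <;> rw [h]
    exacts [hid, (neg_mul _ _).trans_le hneg]
  obtain ⟨ψ, hψ, hlim⟩ := hφ.exists_contDiff_tendsto
  have hbound : ∀ n, |(s k).coeff| * t ≤ (s k).coeff * ⟪ψ n (p + t • v) - ψ n p, v⟫_ℝ
      + (T.mass - ∑ i, ⟪F i, ψ n (M i)⟫_ℝ) := fun n => by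
    rw [← hwork t ht (ψ n) (hψ n).1]
    exact hcost.trans (hT.setIntegral_matrixCost_le (hψ n).1 (hψ n).2 _)
  have hlimit := ge_of_tendsto' (((((hlim _).sub (hlim _)).inner tendsto_const_nhds).const_mul
    _).add (tendsto_const_nhds.sub (tendsto_finsetSum _ fun i _ =>
      tendsto_const_nhds.inner (hlim (M i))))) hbound
  linarith

theorem exists_hasUnitStrainAlong_of_isCompressed (hs : T.IsSpringsNear p s)
    (hT : T.BoundaryEq M F) {φ : Plane → Plane} (hφ : IsDualField φ)
    (hopt : T.mass ≤ ∑ i, ⟪F i, φ (M i)⟫_ℝ) (hv : v ∈ (s k).branchDirs p)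
    (hk : (s k).IsCompressed) : ∃ η > (0 : ℝ), HasUnitStrainAlong φ p (η • v) := by
  obtain ⟨η, hη, h⟩ := hs.exists_abs_coeff_mul_le hT hφ hopt hv
  refine ⟨η, hη, hφ.hasUnitStrainAlong_of_le hη.le (Spring.norm_of_mem_branchDirs hv)
    fun t ht => le_of_mul_le_mul_left ?_ hk⟩
  simpa only [abs_of_pos hk] using h t ht

theorem exists_hasUnitStrainAlong_neg_of_isStretched (hs : T.IsSpringsNear p s)
    (hT : T.BoundaryEq M F) {φ : Plane → Plane} (hφ : IsDualField φ)
    (hopt : T.mass ≤ ∑ i, ⟪F i, φ (M i)⟫_ℝ) (hv : v ∈ (s k).branchDirs p)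
    (hk : (s k).IsStretched) : ∃ η > (0 : ℝ), HasUnitStrainAlong (-φ) p (η • v) := by
  obtain ⟨η, hη, h⟩ := hs.exists_abs_coeff_mul_le hT hφ hopt hv
  refine ⟨η, hη, hφ.neg.hasUnitStrainAlong_of_le hη.le (Spring.norm_of_mem_branchDirs hv)
    fun t ht => le_of_mul_le_mul_left ?_ (neg_pos.2 hk)⟩
  simpa only [abs_of_neg hk, Pi.neg_apply, ← neg_sub', inner_neg_left, neg_mul_neg] using h t ht

theorem inner_nonpos_of_mem_branchDirs (hs : T.IsSpringsNear p s)
    (hT : T.BoundaryEq M F) {φ : Plane → Plane} (hφ : IsDualField φ)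
    (hopt : T.mass ≤ ∑ i, ⟪F i, φ (M i)⟫_ℝ) {k l : κ} {v w : Plane}
    (hv : v ∈ (s k).branchDirs p) (hw : w ∈ (s l).branchDirs p)
    (hk : (s k).IsCompressed) (hl : (s l).IsStretched) : ⟪v, w⟫_ℝ ≤ 0 := by
  obtain ⟨η, hη, hvφ⟩ := hs.exists_hasUnitStrainAlong_of_isCompressed hT hφ hopt hv hk
  obtain ⟨θ, hθ, hwφ⟩ := hs.exists_hasUnitStrainAlong_neg_of_isStretched hT hφ hopt hw hl
  have h := hφ.inner_nonpos_of_hasUnitStrainAlong hvφ hwφ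
  rw [real_inner_smul_left, real_inner_smul_right, ← mul_assoc] at h
  exact nonpos_of_mul_nonpos_right h (mul_pos hη hθ)

end IsSpringsNear

end StressMeasure

theorem mainTheorem7 {ι : Type*} [Fintype ι] (M F : ι → Plane) (hF : IsEquilibrium M F)
    (T : StressMeasure) (hT : T.IsMinimizer M F)
    (p : Plane) (hp : ∀ i, M i ≠ p)
    {κ : Type*} [Fintype κ] (s : κ → Spring) (hs : T.IsSpringsNear p s) :
    ∑ k, (s k).boundaryForce p = 0 ∧
      ∀ k l, (s k).IsStretched → (s l).IsCompressed →
        InnerProductGeometry.angle (s k).dir (s l).dir = Real.pi / 2 := by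
  obtain ⟨φ, hφ, hopt⟩ := hF.exists_isDualField hT.2
  have hbalance := hs.sum_boundaryForce_eq_zero hT.1 hp
  refine ⟨hbalance, fun k l hk hl => ?_⟩
  have hsum : ∑ x : Σ k, (s k).branchDirs p, (s x.1).coeff • (x.2 : Plane) = 0 := by
    rw [← neg_eq_zero, ← hbalance, Fintype.sum_sigma, ← Finset.sum_neg_distrib]
    refine Finset.sum_congr rfl fun k _ => ?_
    rw [Spring.boundaryForce_eq_neg_smul_sum_branchDirs, Finset.smul_sum,
      Finset.sum_coe_sort _ fun v => (s k).coeff • v]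
  obtain ⟨v, hv⟩ := (s k).branchDirs_nonempty p
  obtain ⟨w, hw⟩ := (s l).branchDirs_nonempty p
  have hwv : ⟪w, v⟫_ℝ = 0 := inner_eq_zero_of_sum_smul_eq_zero hsum
    (fun x y hx hy => hs.inner_nonpos_of_mem_branchDirs hT.1 hφ hopt x.2.2 y.2.2 hx hy)
    (i := ⟨l, w, hw⟩) (j := ⟨k, v, hv⟩) hl hk
  rw [← InnerProductGeometry.inner_eq_zero_iff_angle_eq_pi_div_two, real_inner_comm]
  rcases Spring.eq_or_eq_neg_of_mem_branchDirs hv with rfl | rfl <;>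
    rcases Spring.eq_or_eq_neg_of_mem_branchDirs hw with rfl | rfl <;> simpa using hwv
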